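/- Let $(\mathbb K,|\cdot|)$ be a complete ultrametric field (a field with an ultrametric absolute value defining a non-discrete complete topology), and let $E$ be a Hausdorff topological $\mathbb K$-vector space which is locally convex, i.e. the open submodules of $E$ over the valuation ring $\{z\in\mathbb K: |z|\le 1\}$ form a basis of neighbourhoods of $0$. Let $n\in\mathbb N$ and $\alpha\in(\mathbb N_0\cup\{\infty\})^n$. Call a subset of $\mathbb K^n$ *cartesian* if it is a product $U_1\times\cdots\times U_n$ of subsets $U_i\subseteq\mathbb K$ without isolated points, and let $U\subseteq\mathbb K^n$ be a compact cartesian set. For cartesian $V\subseteq\mathbb K^n$ and $\beta\in\mathbb N_0^n$ let $V^{<\beta>}$ be the set of all $x=(x^{(1)},\ldots,x^{(n)})$ with $x^{(i)}=(x^{(i)}_0,\ldots,x^{(i)}_{\beta_i})\in\mathbb K^{1+\beta_i}$ such that $(x^{(1)}_{j_1},\ldots,x^{(n)}_{j_n})\in V$ for all $j_i\in\{0,\ldots,\beta_i\}$, and let $V^{>\beta<}$ be the subset of those $x$ for which the entries of each $x^{(i)}$ are pairwise distinct. For $f\colon V\to E$ define $f^{>\beta<}\colon V^{>\beta<}\to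 E$ by $$f^{>\beta<}(x)=\sum_{j_1=0}^{\beta_1}\cdots\sum_{j_n=0}^{\beta_n}\Big(\prod_{i=1}^n\prod_{k\ne j_i}\frac1{x^{(i)}_{j_i}-x^{(i)}_k}\Big)f(x^{(1)}_{j_1},\ldots,x^{(n)}_{j_n}),$$ where in the inner product $k$ ranges over $\{0,\ldots,\beta_i\}\setminus\{j_i\}$. A function $f\colon U\to E$ is called $C^\alpha$ if, for each relatively open cartesian subset $V\subseteq U$ and each $\beta\in\mathbb N_0^n$ with $\beta\le\alpha$ (componentwise), $(f|_V)^{>\beta<}$ has a (necessarily unique) continuous extension $(f|_V)^{<\beta>}\colon V^{<\beta>}\to E$. The space $C^\alpha(U,E)$ of all these functions is given the initial topology with respect to the maps $C^\alpha(U,E)\to C(V^{<\beta>},E)$, $f\mapsto (f|_V)^{<\beta>}$, for all such $V$ and $\beta$, where $C(V^{<\beta>},E)$ carries the compact-open topology. A function $f\colon U\to E$ is *locally polynomial of multidegree $\le\alpha$* if each $x\in U$ has a relatively open neighbourhood $V\subseteq U$ on which $f$ is of the form $f(y)=\sum_{\beta} y_1^{\beta_1}\cdots y_n^{\beta_n}\,a_\beta$,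 a finite sum over multi-indices $\beta\in\mathbb N_0^n$ with $\beta\le\alpha$ and with coefficients $a_\beta\in E$. Then every locally polynomial function $U\to E$ of multidegree $\le\alpha$ is $C^\alpha$, and the set of these functions is dense in $C^\alpha(U,E)$. -/

import Mathlib

noncomputable section

namespace PartialDiff

open scoped Topology

/-- A subset of `K^n` is cartesian if it is a product of `n` subsets of `K`
none of which has an isolated point. -/
def IsCartesian {K : Type*} [TopologicalSpace K] {n : ℕ} (U : Set (Fin n → K)) : Prop :=
  ∃ S : Fin n → Set K, (∀ i, Preperfect (S i)) ∧ U = Set.univ.pi S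

/-- `V` is a subset of `U` which is open in `U` (relatively open). -/
def IsRelOpen {X : Type*} [TopologicalSpace X] (U V : Set X) : Prop :=
  V ⊆ U ∧ ∃ O : Set X, IsOpen O ∧ V = U ∩ O

/-- The restriction `f|_V` of a function `f : U → E` to a subset `V` of `U`. -/
def restr {X E : Type*} {U V : Set X} (h : V ⊆ U) (f : U → E) : V → E :=
  fun x => f (Set.inclusion h x)

/-- The set `U^{<β>}` of all families `x = (x^{(1)}, …, x^{(n)})` with `x^{(i)} ∈ K^{1+β_i}`
such that `(x^{(1)}_{j_1}, …, x^{(n)}_{j_n}) ∈ U` for all choices of indices `j`. -/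
def fullDom {K : Type*} {n : ℕ} (U : Set (Fin n → K)) (β : Fin n → ℕ) :
    Set ((i : Fin n) → Fin (β i + 1) → K) :=
  {x | ∀ j : (i : Fin n) → Fin (β i + 1), (fun i => x i (j i)) ∈ U}

/-- The set `U^{>β<}` of all `x ∈ U^{<β>}` such that, for each `i`,
the entries of `x^{(i)}` are pairwise distinct. -/
def distinctDom {K : Type*} {n : ℕ} (U : Set (Fin n → K)) (β : Fin n → ℕ) :
    Set ((i : Fin n) → Fin (β i + 1) → K) :=
  {x | x ∈ fullDom U β ∧ ∀ (i : Fin n) (j k : Fin (β i + 1)), j < k → x i j ≠ x i k}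

/-- The iterated partial difference quotient map `f^{>β<} : U^{>β<} → E`. -/
def diffQuot {K E : Type*} [Field K] [AddCommGroup E] [Module K E] {n : ℕ}
    {U : Set (Fin n → K)} (f : U → E) (β : Fin n → ℕ) (x : distinctDom U β) : E :=
  ∑ j : (i : Fin n) → Fin (β i + 1),
    (∏ i, ∏ k ∈ Finset.univ.erase (j i), (x.1 i (j i) - x.1 i k)⁻¹) •
      f ⟨fun i => x.1 i (j i), x.2.1 j⟩

/-- `g : U^{<β>} → E` is a continuous extension of `f^{>β<}`. -/
def IsExtension {K E : Type*} [Field K] [TopologicalSpace K] [AddCommGroup E] [Module K E]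
    [TopologicalSpace E] {n : ℕ} {U : Set (Fin n → K)} (f : U → E) (β : Fin n → ℕ)
    (g : C(fullDom U β, E)) : Prop :=
  ∀ x : distinctDom U β, g ⟨x.1, x.2.1⟩ = diffQuot f β x

/-- `β ≤ α` for `β ∈ ℕ₀^n` and `α ∈ (ℕ₀ ∪ {∞})^n`. -/
def MultiLE {n : ℕ} (β : Fin n → ℕ) (α : Fin n → ℕ∞) : Prop :=
  ∀ i, (β i : ℕ∞) ≤ α i

/-- `C^α`-functions on a cartesian set. -/
def IsCAlphaOnCartesian {K E : Type*} [Field K] [TopologicalSpace K] [AddCommGroup E]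
    [Module K E] [TopologicalSpace E] {n : ℕ} {U : Set (Fin n → K)} (α : Fin n → ℕ∞)
    (f : U → E) : Prop :=
  ∀ β : Fin n → ℕ, MultiLE β α → ∃ g : C(fullDom U β, E), IsExtension f β g

/-- `C^α`-functions on a (locally) cartesian set `U`: the restriction to each cartesian,
relatively open subset of `U` is `C^α`. (If `U` is cartesian, then `U` itself is such a
subset, and the condition for `U` implies the condition for the others.) -/
def IsCAlpha {K E : Type*} [Field K] [TopologicalSpace K] [AddCommGroup E]
    [Module K E] [TopologicalSpace E] {n : ℕ} {U : Set (Fin n → K)} (α : Fin n → ℕ∞)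
    (f : U → E) : Prop :=
  ∀ (V : Set (Fin n → K)) (hV : IsRelOpen U V), IsCartesian V →
    IsCAlphaOnCartesian α (restr hV.1 f)

/-- The space `C^α(U,E)`. -/
def CAlpha {K : Type*} (E : Type*) [Field K] [TopologicalSpace K] [AddCommGroup E]
    [Module K E] [TopologicalSpace E] {n : ℕ} (U : Set (Fin n → K)) (α : Fin n → ℕ∞) :=
  {f : U → E // IsCAlpha α f}

/-- The map `Δ_{β,V} : C^α(U,E) → C(V^{<β>},E)` taking `f` to the continuous
extension `(f|_V)^{<β>}` of `(f|_V)^{>β<}`. The extension is unique when `E` is Hausdorff,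
as `V^{>β<}` is dense in `V^{<β>}` for cartesian `V`. -/
def extMap {K E : Type*} [Field K] [TopologicalSpace K] [AddCommGroup E]
    [Module K E] [TopologicalSpace E] {n : ℕ} {U : Set (Fin n → K)} {α : Fin n → ℕ∞}
    (V : Set (Fin n → K)) (hV : IsRelOpen U V) (hc : IsCartesian V)
    (β : Fin n → ℕ) (hβ : MultiLE β α) (f : CAlpha E U α) : C(fullDom V β, E) :=
  Classical.choose (f.2 V hV hc β hβ)

/-- The compact-open `C^α`-topology: the initial topology with respect to the maps
`Δ_{β,V}`, each `C(V^{<β>},E)` carrying the compact-open topology. -/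
instance CAlpha.instTopologicalSpace {K E : Type*} [Field K] [TopologicalSpace K]
    [AddCommGroup E] [Module K E] [TopologicalSpace E] {n : ℕ} {U : Set (Fin n → K)}
    {α : Fin n → ℕ∞} : TopologicalSpace (CAlpha E U α) :=
  ⨅ (V : Set (Fin n → K)) (hV : IsRelOpen U V) (hc : IsCartesian V)
    (β : Fin n → ℕ) (hβ : MultiLE β α),
      TopologicalSpace.induced (extMap V hV hc β hβ) ContinuousMap.compactOpen

/-- Polynomial functions `U → E` of multidegree `≤ α`. -/
def IsPolyFun {K E : Type*} [Field K] [AddCommGroup E] [Module K E] {n : ℕ}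
    {U : Set (Fin n → K)} (α : Fin n → ℕ∞) (p : U → E) : Prop :=
  ∃ a : (Fin n → ℕ) →₀ E, (∀ β ∈ a.support, MultiLE β α) ∧
    ∀ x : U, p x = a.sum fun β c => (∏ i, x.1 i ^ β i) • c

/-- Locally polynomial functions `U → E` of multidegree `≤ α`. -/
def IsLocPol {K E : Type*} [Field K] [TopologicalSpace K] [AddCommGroup E] [Module K E]
    {n : ℕ} {U : Set (Fin n → K)} (α : Fin n → ℕ∞) (f : U → E) : Prop :=
  ∀ x ∈ U, ∃ (V : Set (Fin n → K)) (hV : IsRelOpen U V), x ∈ V ∧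
    IsPolyFun α (restr hV.1 f)

/-- Local convexity over an ultrametric field `K`: the open submodules over the valuation
ring `{z ∈ K : |z| ≤ 1}` form a basis of neighbourhoods of `0`. -/
def IsLocallyConvex (K E : Type*) [NontriviallyNormedField K] [IsUltrametricDist K]
    [AddCommGroup E] [Module K E] [TopologicalSpace E] : Prop :=
  (𝓝 (0 : E)).HasBasis
    (fun M : Submodule (NormedField.valuation (K := K)).integer E => IsOpen (M : Set E))
    (fun M => (M : Set E))

end PartialDiff

end

noncomputable section

namespace PartialDiff

open scoped Topology
open Filter Classical

/-! Difference quotients are rewritten as divided differences over finite sets, ruled by the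
recursion φ[A∖b] − φ[A∖a] = (a − b) φ[A] (`divDiff_erase_sub_divDiff_erase`).

Density. Local convexity reduces a neighbourhood of f to finitely many orders β ≤ N and one open
submodule W. By compactness (`exists_gridDiff_sub_mem`) there is ρ such that, in each direction,
differences of top order over point sets of mutual distance < |ρ| agree modulo W. Cut each factor
into balls of radius |ρ| and interpolate on each ball at N + 1 nodes. The error vanishes at the
nodes and has top-order differences in W. Exchanging points for nodes gains one factor ρ per lost
order, so differences of order N − m over small sets lie in ρ^m W (`divDiff_mem_of_nodes`). Over
wider sets, dividing by a − b with |a − b| ≥ |ρ| costs at most that one factor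
(`divDiff_mem_of_local`). Treating the variables one at a time gives the approximant
(`exists_piecewise_polynomial`).

Locally polynomial functions are C^α because their difference quotients converge at every point of
the full domain (`exists_tendsto_gridDiff`): points with distinct limits are separated by the
recursion, and coalescing ones see a single polynomial. -/

lemma injective_of_mem_distinctDom {K : Type*} {n : ℕ} {U : Set (Fin n → K)} {β : Fin n → ℕ}
    {x : (i : Fin n) → Fin (β i + 1) → K} (hx : x ∈ distinctDom U β) (i : Fin n) :
    Function.Injective (x i) := by
  intro j k hjk
  by_contra hne
  rcases lt_or_gt_of_ne hne with h | h
  · exact hx.2 i j k h hjk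
  · exact hx.2 i k j h hjk.symm

/-! ### Divided differences in one and several variables -/

section DividedDifferences

variable {K E : Type*} [Field K] [AddCommGroup E] [Module K E] {n : ℕ}

/-- The coefficient of `φ a` in the divided difference of `φ` at the points of `A`. -/
def weight (A : Finset K) (a : K) : K := ∏ b ∈ A.erase a, (a - b)⁻¹

/-- The divided difference of a function of one variable at the points of a finite set. -/
def divDiff (φ : K → E) (A : Finset K) : E := ∑ a ∈ A, weight A a • φ a

/-- The partial divided difference of a function of `n` variables at a finite grid. -/
def gridDiff (f : (Fin n → K) → E) (A : Fin n → Finset K) : E :=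
  ∑ a ∈ Fintype.piFinset A, (∏ i, weight (A i) (a i)) • f a

lemma weight_mul_sub {A : Finset K} {a b : K} (hb : b ∈ A) (hab : a ≠ b) :
    weight A a * (a - b) = weight (A.erase b) a := by
  have hb' : b ∈ A.erase a := Finset.mem_erase.2 ⟨hab.symm, hb⟩
  rw [weight, ← Finset.mul_prod_erase _ _ hb', weight, Finset.erase_right_comm, mul_comm,
    ← mul_assoc, mul_inv_cancel₀ (sub_ne_zero.2 hab), one_mul]

/-- The factor a − b kills the term at b and cancels one denominator in every other weight; the
recursion follows. -/
lemma divDiff_erase (φ : K → E) {A : Finset K} {b : K} (hb : b ∈ A) :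
    divDiff φ (A.erase b) = divDiff (fun a => (a - b) • φ a) A := by
  rw [divDiff, divDiff, ← Finset.add_sum_erase A _ hb, sub_self, zero_smul, smul_zero, zero_add]
  refine Finset.sum_congr rfl fun a ha => ?_
  rw [← weight_mul_sub hb (Finset.ne_of_mem_erase ha), mul_smul]

lemma divDiff_erase_sub_divDiff_erase (φ : K → E) {A : Finset K} {a b : K} (ha : a ∈ A)
    (hb : b ∈ A) :
    divDiff φ (A.erase b) - divDiff φ (A.erase a) = (a - b) • divDiff φ A := by
  rw [divDiff_erase φ ha, divDiff_erase φ hb, divDiff, divDiff, divDiff, ← Finset.sum_sub_distrib,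
    Finset.smul_sum]
  refine Finset.sum_congr rfl fun c _ => ?_
  rw [smul_smul, smul_smul, smul_smul, ← sub_smul]
  congr 1
  ring

lemma divDiff_eq_smul_sub (φ : K → E) {A : Finset K} {a b : K} (ha : a ∈ A) (hb : b ∈ A)
    (hab : a ≠ b) :
    divDiff φ A = (a - b)⁻¹ • (divDiff φ (A.erase b) - divDiff φ (A.erase a)) := by
  rw [divDiff_erase_sub_divDiff_erase φ ha hb, smul_smul, inv_mul_cancel₀ (sub_ne_zero.2 hab),
    one_smul]

lemma divDiff_congr {φ ψ : K → E} {A : Finset K} (h : ∀ a ∈ A, φ a = ψ a) :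
    divDiff φ A = divDiff ψ A :=
  Finset.sum_congr rfl fun a ha => by rw [h a ha]

lemma divDiff_sub (φ ψ : K → E) (A : Finset K) :
    divDiff (fun a => φ a - ψ a) A = divDiff φ A - divDiff ψ A := by
  simp only [divDiff, smul_sub, Finset.sum_sub_distrib]

lemma divDiff_eval {P : Polynomial K} {A : Finset K} (hP : P.degree < A.card) :
    divDiff (fun t => P.eval t) A = P.coeff (A.card - 1) := by
  rw [Lagrange.coeff_eq_sum (v := id) (Set.injOn_id _) hP, divDiff]
  refine Finset.sum_congr rfl fun a _ => ?_
  rw [weight, Finset.prod_inv_distrib, smul_eq_mul, div_eq_mul_inv, mul_comm]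
  rfl

/-- The interpolation polynomial function of degree `< #Q` with values `φ q` at the nodes `q`. -/
def interp (φ : K → E) (Q : Finset K) (t : K) : E :=
  ∑ q ∈ Q, (Lagrange.basis Q id q).eval t • φ q

lemma interp_node (φ : K → E) {Q : Finset K} {q : K} (hq : q ∈ Q) : interp φ Q q = φ q := by
  rw [interp, Finset.sum_eq_single q]
  · have := Lagrange.eval_basis_self (v := id) (Set.injOn_id _) hq
    simp only [id] at this
    rw [this, one_smul]
  · intro b _ hb
    have := Lagrange.eval_basis_of_ne (v := id) hb hq
    simp only [id] at this
    rw [this, zero_smul]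
  · exact fun h => absurd hq h

/-- A polynomial of degree < #Q has the same divided difference over every set of #Q points, namely
its coefficient of degree #Q − 1; over Q itself it agrees with φ. -/
lemma divDiff_interp (φ : K → E) {Q A : Finset K} (h : A.card = Q.card) :
    divDiff (interp φ Q) A = divDiff φ Q := by
  have key : ∀ B : Finset K, B.card = Q.card → divDiff (interp φ Q) B =
      ∑ q ∈ Q, (Lagrange.basis Q id q).coeff (Q.card - 1) • φ q := by
    intro B hB
    have : divDiff (interp φ Q) B =
        ∑ q ∈ Q, divDiff (fun t => (Lagrange.basis Q id q).eval t) B • φ q := by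
      simp only [divDiff, interp, Finset.smul_sum, Finset.sum_smul, smul_smul, smul_eq_mul]
      exact Finset.sum_comm
    rw [this]
    refine Finset.sum_congr rfl fun q hq => ?_
    rw [divDiff_eval, hB]
    rw [Lagrange.degree_basis (Set.injOn_id _) hq, hB]
    exact_mod_cast Nat.sub_lt (Finset.card_pos.2 ⟨q, hq⟩) one_pos
  rw [key A h, ← key Q rfl]
  exact divDiff_congr fun a ha => interp_node φ ha

lemma gridDiff_congr {f g : (Fin n → K) → E} {A : Fin n → Finset K}
    (h : ∀ a, (∀ i, a i ∈ A i) → f a = g a) : gridDiff f A = gridDiff g A :=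
  Finset.sum_congr rfl fun a ha => by rw [h a (Fintype.mem_piFinset.1 ha)]

lemma gridDiff_sum_smul {ι : Type*} (s : Finset ι) (c : ι → K) (f : ι → (Fin n → K) → E)
    (A : Fin n → Finset K) :
    gridDiff (fun a => ∑ q ∈ s, c q • f q a) A = ∑ q ∈ s, c q • gridDiff (f q) A := by
  simp only [gridDiff, Finset.smul_sum]
  rw [Finset.sum_comm]
  refine Finset.sum_congr rfl fun q _ => Finset.sum_congr rfl fun a _ => ?_
  rw [smul_comm]

lemma gridDiff_of_empty (f : (Fin n → K) → E) {A : Fin n → Finset K} {i : Fin n} (h : A i = ∅) :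
    gridDiff f A = 0 := by
  rw [gridDiff, Fintype.piFinset_eq_empty.2 ⟨i, h⟩, Finset.sum_empty]

lemma gridDiff_prod_smul (φ : Fin n → K → K) (e : E) (A : Fin n → Finset K) :
    gridDiff (fun a => (∏ i, φ i (a i)) • e) A = (∏ i, divDiff (φ i) (A i)) • e := by
  simp only [gridDiff, divDiff, smul_smul, smul_eq_mul, ← Finset.sum_smul, Finset.prod_univ_sum,
    Finset.prod_mul_distrib]

lemma weight_singleton (t : K) : weight {t} t = 1 := by
  simp [weight]

/-- A grid with a single value in direction `i` may be moved to a different value. -/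
lemma gridDiff_update_singleton (f : (Fin n → K) → E) (A : Fin n → Finset K) (i : Fin n)
    (t c : K) : gridDiff f (Function.update A i {t}) =
      gridDiff (fun a => f (Function.update a i t)) (Function.update A i {c}) := by
  have mem : ∀ (t : K) (a : Fin n → K), a ∈ Fintype.piFinset (Function.update A i {t}) →
      a i = t ∧ ∀ k, k ≠ i → a k ∈ A k := by
    intro t a ha
    rw [Fintype.mem_piFinset] at ha
    refine ⟨by simpa using ha i, fun k hk => by simpa [hk] using ha k⟩
  have mem' : ∀ (s t : K) (a : Fin n → K), a ∈ Fintype.piFinset (Function.update A i {t}) →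
      Function.update a i s ∈ Fintype.piFinset (Function.update A i {s}) := by
    intro s t a ha
    rw [Fintype.mem_piFinset]
    intro k
    by_cases hk : k = i
    · subst hk; simp
    · simpa [hk] using (mem t a ha).2 k hk
  refine Finset.sum_nbij' (fun a => Function.update a i c) (fun a => Function.update a i t)
    (fun a ha => mem' c t a ha) (fun a ha => mem' t c a ha) (fun a ha => ?_) (fun a ha => ?_)
    (fun a ha => ?_)
  · simp [← (mem t a ha).1]
  · simp [← (mem c a ha).1]
  · congr 1
    · refine Finset.prod_congr rfl fun k _ => ?_
      by_cases hk : k = i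
      · subst hk; simp [(mem t a ha).1, weight]
      · simp [hk]
    · simp [← (mem t a ha).1]

/-- Sum over the fibres of the i-th coordinate. A singleton has weight 1, so putting {t} in
direction i merely freezes that variable; one-variable results thus apply to grids. -/
lemma gridDiff_eq_divDiff (f : (Fin n → K) → E) (A : Fin n → Finset K) (i : Fin n) :
    gridDiff f A = divDiff (fun t => gridDiff f (Function.update A i {t})) (A i) := by
  rw [gridDiff, ← Finset.sum_fiberwise_of_maps_to (g := fun a => a i) (t := A i)
    (fun a ha => Fintype.mem_piFinset.1 ha i), divDiff]
  refine Finset.sum_congr rfl fun t ht => ?_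
  rw [gridDiff, Fintype.piFinset_update_singleton_eq_filter_piFinset_eq _ _ ht, Finset.smul_sum]
  refine Finset.sum_congr rfl fun a ha => ?_
  have hat : a i = t := (Finset.mem_filter.1 ha).2
  rw [smul_smul]
  congr 1
  rw [← Finset.mul_prod_erase _ _ (Finset.mem_univ i), hat,
    ← Finset.mul_prod_erase _ (fun k => weight (Function.update A i {t} k) (a k))
    (Finset.mem_univ i), Function.update_self, hat, weight_singleton t, one_mul]
  congr 1
  refine Finset.prod_congr rfl fun k hk => ?_
  rw [Function.update_of_ne (Finset.ne_of_mem_erase hk)]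

lemma gridDiff_update_eq_divDiff (f : (Fin n → K) → E) (A : Fin n → Finset K) (i : Fin n)
    (B : Finset K) : gridDiff f (Function.update A i B) =
      divDiff (fun t => gridDiff f (Function.update A i {t})) B := by
  rw [gridDiff_eq_divDiff f _ i, Function.update_self]
  simp only [Function.update_idem]

lemma gridDiff_eq_smul_sub (f : (Fin n → K) → E) (A : Fin n → Finset K) (i : Fin n) {a b : K}
    (ha : a ∈ A i) (hb : b ∈ A i) (hab : a ≠ b) :
    gridDiff f A = (a - b)⁻¹ • (gridDiff f (Function.update A i ((A i).erase b)) -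
      gridDiff f (Function.update A i ((A i).erase a))) := by
  rw [gridDiff_eq_divDiff f A i, gridDiff_update_eq_divDiff, gridDiff_update_eq_divDiff]
  exact divDiff_eq_smul_sub _ ha hb hab

/-- The quotient is symmetric in the entries of each x^{(i)}, so only their sets matter. Using F on
all of K^n avoids carrying membership proofs. -/
lemma diffQuot_eq_gridDiff {U : Set (Fin n → K)} {f : U → E} {F : (Fin n → K) → E}
    (hF : ∀ x : U, F x = f x) {β : Fin n → ℕ} (x : distinctDom U β) :
    diffQuot f β x = gridDiff F (fun i => Finset.univ.image (x.1 i)) := by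
  have inj := injective_of_mem_distinctDom x.2
  rw [gridDiff, Fintype.piFinset_image, Finset.sum_image, Fintype.piFinset_univ, diffQuot]
  · refine Finset.sum_congr rfl fun j _ => ?_
    congr 1
    · refine Finset.prod_congr rfl fun i _ => ?_
      rw [weight, ← Finset.image_erase (inj i), Finset.prod_image (inj i).injOn]
    · exact (hF ⟨fun i => x.1 i (j i), x.2.1 j⟩).symm
  · intro j _ j' _ h
    funext i
    exact inj i (congrFun h i)

/-- Piecewise polynomial interpolation in the `i`-th variable. -/
def interpAt (Q : K → Finset K) (i : Fin n) (f : (Fin n → K) → E) (y : Fin n → K) : E :=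
  interp (fun t => f (Function.update y i t)) (Q (y i)) (y i)

/-- Interpolation in variable i is linear in the values of f, hence commutes with differences in the
other variables. -/
lemma gridDiff_interpAt (Q : K → Finset K) (i : Fin n) (f : (Fin n → K) → E)
    (A : Fin n → Finset K) (t : K) :
    gridDiff (interpAt Q i f) (Function.update A i {t}) =
      interp (fun s => gridDiff f (Function.update A i {s})) (Q t) t := by
  have : ∀ s, gridDiff f (Function.update A i {s}) =
      gridDiff (fun a => f (Function.update a i s)) (Function.update A i {t}) :=
    fun s => gridDiff_update_singleton f A i s t
  simp only [interp, this]
  rw [← gridDiff_sum_smul]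
  refine gridDiff_congr fun a ha => ?_
  have hat : a i = t := by simpa using ha i
  simp only [interpAt, interp, hat]

end DividedDifferences
-- Finite grids of bounded size
section Grids

variable {K : Type*} {n : ℕ}

/-- The grids in `∏ S i` with at least one and at most `N i + 1` points in direction `i`. -/
structure IsGrid (S : Fin n → Set K) (N : Fin n → ℕ) (A : Fin n → Finset K) : Prop where
  subset : ∀ i, (A i : Set K) ⊆ S i
  nonempty : ∀ i, (A i).Nonempty
  card_le : ∀ i, (A i).card ≤ N i + 1

lemma IsGrid.update {S : Fin n → Set K} {N : Fin n → ℕ} {A : Fin n → Finset K}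
    (hA : IsGrid S N A) {i : Fin n} {B : Finset K} (hB : (B : Set K) ⊆ S i)
    (hcard : B.card = N i + 1) : IsGrid S N (Function.update A i B) := by
  refine ⟨fun k => ?_, fun k => ?_, fun k => ?_⟩ <;> by_cases hk : k = i
  · subst hk; simpa using hB
  · simpa [hk] using hA.subset k
  · subst hk; simpa using Finset.card_pos.1 (by omega)
  · simpa [hk] using hA.nonempty k
  · subst hk; simp [hcard]
  · simpa [hk] using hA.card_le k

end Grids

/-! ### Error estimates for interpolation on small balls -/

section Interpolation

variable {K E : Type*} [NontriviallyNormedField K] [AddCommGroup E] [Module K E] {n : ℕ}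
  {W : AddSubgroup E}

/-- Here m is the number of orders below the top. For a ∈ A∖Q and b ∈ Q∖A, ψ[A] = ψ[A − a + b] + (a
− b) ψ[A + b]: the first term has fewer points outside Q, the second is one order higher and gains a
factor ρ. -/
lemma divDiff_mem_of_nodes (hW : ∀ z : K, ‖z‖ ≤ 1 → ∀ w ∈ W, z • w ∈ W) {ψ : K → E} {ρ : K}
    (hρ : ρ ≠ 0) {B : Set K} (hB : ∀ x ∈ B, ∀ y ∈ B, ‖x - y‖ ≤ ‖ρ‖) {N : ℕ} {Q : Finset K}
    (hQB : (Q : Set K) ⊆ B) (hQ : Q.card = N + 1) (hψ : ∀ q ∈ Q, ψ q = 0)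
    (htop : ∀ A : Finset K, (A : Set K) ⊆ B → A.card = N + 1 → divDiff ψ A ∈ W) (m : ℕ) :
    ∀ A : Finset K, (A : Set K) ⊆ B → A.card + m = N + 1 → (ρ ^ m)⁻¹ • divDiff ψ A ∈ W := by
  induction m with
  | zero => intro A hA hc; simpa using htop A hA hc
  | succ m ih =>
    suffices ∀ k : ℕ, ∀ A : Finset K, (A \ Q).card = k → (A : Set K) ⊆ B →
        A.card + (m + 1) = N + 1 → (ρ ^ (m + 1))⁻¹ • divDiff ψ A ∈ W from
      fun A hA hc => this _ A rfl hA hc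
    intro k
    induction k with
    | zero =>
      intro A hk hA hc
      have hAQ : A ⊆ Q := by simpa [Finset.sdiff_eq_empty_iff_subset] using hk
      have : divDiff ψ A = 0 :=
        Finset.sum_eq_zero fun a ha => by rw [hψ a (hAQ ha), smul_zero]
      rw [this, smul_zero]
      exact W.zero_mem
    | succ k ihk =>
      intro A hk hA hc
      obtain ⟨a, ha⟩ : (A \ Q).Nonempty := Finset.card_pos.1 (by omega)
      obtain ⟨haA, haQ⟩ := Finset.mem_sdiff.1 ha
      obtain ⟨b, hbQ, hbA⟩ : ∃ b ∈ Q, b ∉ A := by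
        by_contra! h
        have := Finset.card_le_card (show Q ⊆ A from h)
        omega
      have hCB : ((insert b A : Finset K) : Set K) ⊆ B := by
        intro x hx
        rcases Finset.mem_insert.1 (Finset.mem_coe.1 hx) with rfl | hx
        · exact hQB hbQ
        · exact hA hx
      have hCcard : (insert b A).card = A.card + 1 := Finset.card_insert_of_notMem hbA
      have h1 := divDiff_erase_sub_divDiff_erase ψ (Finset.mem_insert_of_mem haA : a ∈ insert b A)
        (Finset.mem_insert_self b A)
      rw [Finset.erase_insert hbA] at h1
      have hA' := ihk ((insert b A).erase a) (by
        have : (insert b A).erase a \ Q = (A \ Q).erase a := by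
          ext x
          simp only [Finset.mem_sdiff, Finset.mem_erase, Finset.mem_insert]
          constructor
          · rintro ⟨⟨h1, rfl | h2⟩, h3⟩
            · exact absurd hbQ h3
            · exact ⟨h1, h2, h3⟩
          · rintro ⟨h1, h2, h3⟩
            exact ⟨⟨h1, Or.inr h2⟩, h3⟩
        rw [this, Finset.card_erase_of_mem ha]
        omega)
        (fun x hx => hCB (Finset.mem_of_mem_erase (Finset.mem_coe.1 hx))) (by
          rw [Finset.card_erase_of_mem (Finset.mem_insert_of_mem haA), hCcard]
          omega)
      have hC := ih (insert b A) hCB (by omega)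
      have hz : ‖(a - b) * ρ⁻¹‖ ≤ 1 := by
        rw [norm_mul, norm_inv]
        exact mul_inv_le_one_of_le₀ (hB a (hA haA) b (hQB hbQ)) (norm_nonneg _)
      have heq : (ρ ^ (m + 1))⁻¹ • divDiff ψ A =
          (ρ ^ (m + 1))⁻¹ • divDiff ψ ((insert b A).erase a) +
            ((a - b) * ρ⁻¹) • (ρ ^ m)⁻¹ • divDiff ψ (insert b A) := by
        rw [eq_add_of_sub_eq h1, smul_add, smul_smul, smul_smul, add_comm]
        congr 2
        rw [pow_succ]
        field_simp
      rw [heq]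
      exact W.add_mem hA' (hW _ hz _ hC)

/-- If |a − b| ≥ |ρ| for some a, b ∈ A, the recursion expresses ψ[A] by sets one point smaller,
whose differences lie in ρ^(m+1) W; dividing by a − b loses at most one factor ρ. -/
lemma divDiff_mem_of_local (hW : ∀ z : K, ‖z‖ ≤ 1 → ∀ w ∈ W, z • w ∈ W) {ψ : K → E} {ρ : K}
    (hρ : ρ ≠ 0) {S : Set K} {N : ℕ}
    (hloc : ∀ A : Finset K, (A : Set K) ⊆ S → (∀ x ∈ A, ∀ y ∈ A, ‖x - y‖ < ‖ρ‖) → ∀ m,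
      A.card + m = N + 1 → (ρ ^ m)⁻¹ • divDiff ψ A ∈ W) (k : ℕ) :
    ∀ (A : Finset K) (m : ℕ), A.card = k → (A : Set K) ⊆ S → A.card + m = N + 1 →
      (ρ ^ m)⁻¹ • divDiff ψ A ∈ W := by
  induction k with
  | zero =>
    intro A m hk _ _
    rw [Finset.card_eq_zero.1 hk, divDiff, Finset.sum_empty, smul_zero]
    exact W.zero_mem
  | succ k ih =>
    intro A m hk hA hm
    by_cases hclose : ∀ x ∈ A, ∀ y ∈ A, ‖x - y‖ < ‖ρ‖
    · exact hloc A hA hclose m hm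
    push Not at hclose
    obtain ⟨a, ha, b, hb, hab⟩ := hclose
    have hpos : 0 < ‖a - b‖ := (norm_pos_iff.2 hρ).trans_le hab
    have hne : a - b ≠ 0 := norm_pos_iff.1 hpos
    have key : ∀ c ∈ A, (ρ ^ (m + 1))⁻¹ • divDiff ψ (A.erase c) ∈ W := fun c hc =>
      ih _ (m + 1) (by rw [Finset.card_erase_of_mem hc]; omega)
        (fun x hx => hA (Finset.mem_of_mem_erase (Finset.mem_coe.1 hx)))
        (by rw [Finset.card_erase_of_mem hc]; omega)
    have hz : ‖(a - b)⁻¹ * ρ‖ ≤ 1 := by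
      rw [norm_mul, norm_inv]
      exact inv_mul_le_one_of_le₀ hab (norm_nonneg _)
    have := hW _ hz _ (W.sub_mem (key b hb) (key a ha))
    rw [divDiff_eq_smul_sub ψ ha hb (sub_ne_zero.1 hne)]
    rw [← smul_sub, smul_smul] at this
    rw [smul_smul]
    convert this using 2
    rw [pow_succ]
    field_simp

/-- A choice of `N + 1` nodes in each ball of radius `r` of `S`. -/
structure IsNodeChoice (S : Set K) (r : ℝ) (N : ℕ) (Q : K → Finset K) : Prop where
  subset : ∀ t ∈ S, (Q t : Set K) ⊆ S
  close : ∀ t ∈ S, ∀ q ∈ Q t, ‖q - t‖ < r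
  card : ∀ t ∈ S, (Q t).card = N + 1
  eq_of_close : ∀ t t', ‖t - t'‖ < r → Q t = Q t'

lemma exists_isNodeChoice [IsUltrametricDist K] {S : Set K} (hS : Preperfect S) {r : ℝ}
    (hr : 0 < r) (N : ℕ) : ∃ Q : K → Finset K, IsNodeChoice S r N Q := by
  -- Nodes are chosen per set, not per point, so points with the same ball share their nodes.
  have h : ∀ B : Set K, ∃ q : Finset K, B.Infinite → (q : Set K) ⊆ B ∧ q.card = N + 1 := by
    intro B
    by_cases hB : B.Infinite
    · obtain ⟨q, hq⟩ := hB.exists_subset_card_eq (N + 1)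
      exact ⟨q, fun _ => hq⟩
    · exact ⟨∅, fun h => absurd h hB⟩
  choose q hq using h
  have inf : ∀ t ∈ S, (Metric.ball t r ∩ S).Infinite := fun t ht =>
    Set.Infinite.of_accPt ((hS t ht).nhds_inter (Metric.ball_mem_nhds t hr))
  refine ⟨fun t => q (Metric.ball t r ∩ S), ⟨fun t ht => ?_, fun t ht x hx => ?_, fun t ht => ?_,
    fun t t' htt' => ?_⟩⟩
  · exact (hq _ (inf t ht)).1.trans Set.inter_subset_right
  · have := ((hq _ (inf t ht)).1 hx).1
    rwa [Metric.mem_ball, dist_eq_norm] at this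
  · exact (hq _ (inf t ht)).2
  · have : Metric.ball t r = Metric.ball t' r :=
      (IsUltrametricDist.ball_eq_of_mem (by rwa [Metric.mem_ball, dist_eq_norm])).symm
    simp only [this]

variable [IsUltrametricDist K]

lemma norm_sub_lt_of_lt {x y z : K} {r : ℝ} (h1 : ‖x - y‖ < r) (h2 : ‖y - z‖ < r) :
    ‖x - z‖ < r := by
  have : x - z = (x - y) + (y - z) := by ring
  rw [this]
  exact (IsUltrametricDist.norm_add_le_max _ _).trans_lt (max_lt h1 h2)

/-- Piecewise polynomial interpolation on small balls approximates the divided differences. -/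
lemma divDiff_sub_divDiff_interp_mem (hW : ∀ z : K, ‖z‖ ≤ 1 → ∀ w ∈ W, z • w ∈ W) {ρ : K}
    (hρ : ρ ≠ 0) (hρ1 : ‖ρ‖ ≤ 1) {S : Set K} {N : ℕ} {Q : K → Finset K}
    (hQ : IsNodeChoice S ‖ρ‖ N Q) {φ : K → E}
    (hφ : ∀ A B : Finset K, (A : Set K) ⊆ S → (B : Set K) ⊆ S → A.card = N + 1 →
      B.card = N + 1 → (∀ x ∈ A, ∀ y ∈ B, ‖x - y‖ < ‖ρ‖) → divDiff φ A - divDiff φ B ∈ W)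
    (A : Finset K) (hA : (A : Set K) ⊆ S) (hcard : A.card ≤ N + 1) :
    divDiff φ A - divDiff (fun t => interp φ (Q t) t) A ∈ W := by
  obtain ⟨m, hm⟩ := Nat.exists_eq_add_of_le hcard
  -- The sharper bound ρ^m W is what the induction needs; the factor is dropped at the end because
  -- |ρ| ≤ 1.
  have key : (ρ ^ m)⁻¹ • divDiff (fun t => φ t - interp φ (Q t) t) A ∈ W := by
    refine divDiff_mem_of_local hW hρ ?_ _ A m rfl hA hm.symm
    intro A hA hclose m hm
    rcases A.eq_empty_or_nonempty with rfl | ⟨t, ht⟩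
    · rw [divDiff, Finset.sum_empty, smul_zero]
      exact W.zero_mem
    have htS := hA ht
    -- A lies in one ball, where the piecewise interpolant is a single polynomial.
    have heq : divDiff (fun t => φ t - interp φ (Q t) t) A =
        divDiff (fun s => φ s - interp φ (Q t) s) A :=
      divDiff_congr fun a ha => by rw [hQ.eq_of_close a t (hclose a ha t ht)]
    rw [heq]
    refine divDiff_mem_of_nodes hW hρ (B := {x | x ∈ S ∧ ‖x - t‖ < ‖ρ‖}) (Q := Q t) ?_ ?_
      (hQ.card t htS) ?_ ?_ m A (fun a ha => ⟨hA ha, hclose a ha t ht⟩) hm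
    · rintro x ⟨_, hx⟩ y ⟨_, hy⟩
      exact (norm_sub_lt_of_lt hx (by rwa [norm_sub_rev])).le
    · exact fun q hq => ⟨hQ.subset t htS hq, hQ.close t htS q hq⟩
    · intro q hq
      rw [interp_node φ hq, sub_self]
    · intro A' hA' hc
      rw [divDiff_sub, divDiff_interp φ (hc.trans (hQ.card t htS).symm)]
      refine hφ _ _ (fun a ha => (hA' ha).1) (hQ.subset t htS) hc (hQ.card t htS)
        fun x hx y hy => ?_
      exact norm_sub_lt_of_lt (hA' hx).2 (by rw [norm_sub_rev]; exact hQ.close t htS y hy)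
  have := hW (ρ ^ m) (by rw [norm_pow]; exact pow_le_one₀ (norm_nonneg _) hρ1) _ key
  rwa [smul_smul, mul_inv_cancel₀ (pow_ne_zero _ hρ), one_smul, divDiff_sub] at this

lemma gridDiff_sub_interpAt_mem (hW : ∀ z : K, ‖z‖ ≤ 1 → ∀ w ∈ W, z • w ∈ W) {ρ : K}
    (hρ : ρ ≠ 0) (hρ1 : ‖ρ‖ ≤ 1) {S : Fin n → Set K} {N : Fin n → ℕ} {i : Fin n}
    {Q : K → Finset K} (hQ : IsNodeChoice (S i) ‖ρ‖ (N i) Q) {f : (Fin n → K) → E}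
    (hf : ∀ A, IsGrid S N A → ∀ B B' : Finset K, (B : Set K) ⊆ S i → (B' : Set K) ⊆ S i →
      B.card = N i + 1 → B'.card = N i + 1 → (∀ x ∈ B, ∀ y ∈ B', ‖x - y‖ < ‖ρ‖) →
      gridDiff f (Function.update A i B) - gridDiff f (Function.update A i B') ∈ W)
    {A : Fin n → Finset K} (hA : IsGrid S N A) :
    gridDiff f A - gridDiff (interpAt Q i f) A ∈ W := by
  rw [gridDiff_eq_divDiff f A i, gridDiff_eq_divDiff (interpAt Q i f) A i]
  simp only [gridDiff_interpAt]
  refine divDiff_sub_divDiff_interp_mem hW hρ hρ1 hQ (fun B B' hB hB' hc hc' hBB' => ?_) (A i)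
    (hA.subset i) (hA.card_le i)
  rw [← gridDiff_update_eq_divDiff, ← gridDiff_update_eq_divDiff]
  exact hf A hA B B' hB hB' hc hc' hBB'

end Interpolation

/-! ### Polynomials in a subset of the variables -/

section PolynomialPieces

variable {K E : Type*} [Field K] [AddCommGroup E] [Module K E] {n : ℕ}

variable (K E) in
/-- Polynomial functions of multidegree `≤ N` in the variables in `s`. -/
def polySpan (N : Fin n → ℕ) (s : Finset (Fin n)) : Submodule K ((Fin n → K) → E) :=
  Submodule.span K {p | ∃ (γ : Fin n → ℕ) (e : E), (∀ i, γ i ≤ N i) ∧ (∀ i, i ∉ s → γ i = 0) ∧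
    p = fun y => (∏ i, y i ^ γ i) • e}

lemma polySpan_eq_of_eqOn {N : Fin n → ℕ} {s : Finset (Fin n)} {p : (Fin n → K) → E}
    (hp : p ∈ polySpan K E N s) {y y' : Fin n → K} (h : ∀ i ∈ s, y i = y' i) : p y = p y' := by
  induction hp using Submodule.span_induction with
  | mem p hp =>
    obtain ⟨γ, e, _, h0, rfl⟩ := hp
    beta_reduce
    congr 1
    refine Finset.prod_congr rfl fun i _ => ?_
    by_cases hi : i ∈ s
    · rw [h i hi]
    · rw [h0 i hi, pow_zero, pow_zero]
  | zero => rfl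
  | add p q _ _ hp hq => simp only [Pi.add_apply, hp, hq]
  | smul c p _ hp => simp only [Pi.smul_apply, hp]

lemma const_mem_polySpan (N : Fin n → ℕ) (s : Finset (Fin n)) (e : E) :
    (fun _ => e) ∈ polySpan K E N s :=
  Submodule.subset_span ⟨fun _ => 0, e, fun _ => Nat.zero_le _, fun _ _ => rfl, by simp⟩

lemma pow_smul_mem_polySpan {N : Fin n → ℕ} {s : Finset (Fin n)} {i : Fin n} (hi : i ∉ s) {m : ℕ}
    (hm : m ≤ N i) {p : (Fin n → K) → E} (hp : p ∈ polySpan K E N s) :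
    (fun y => y i ^ m • p y) ∈ polySpan K E N (insert i s) := by
  induction hp using Submodule.span_induction with
  | mem p hp =>
    obtain ⟨γ, e, hN, h0, rfl⟩ := hp
    refine Submodule.subset_span ⟨Function.update γ i m, e, fun k => ?_, fun k hk => ?_, ?_⟩
    · by_cases hk : k = i
      · subst hk; simpa using hm
      · simpa [hk] using hN k
    · rw [Finset.mem_insert, not_or] at hk
      simpa [hk.1] using h0 k hk.2
    · funext y
      rw [smul_smul, ← Finset.mul_prod_erase _ _ (Finset.mem_univ i), h0 i hi, pow_zero, one_mul,
        ← Finset.mul_prod_erase _ (fun k => y k ^ Function.update γ i m k) (Finset.mem_univ i),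
        Function.update_self]
      congr 2
      refine Finset.prod_congr rfl fun k hk => ?_
      rw [Function.update_of_ne (Finset.ne_of_mem_erase hk)]
  | zero =>
    rw [show (fun y : Fin n → K => y i ^ m • (0 : (Fin n → K) → E) y) = 0 from
      funext fun y => smul_zero _]
    exact Submodule.zero_mem _
  | add p q _ _ hp hq =>
    simp only [Pi.add_apply, smul_add]
    exact Submodule.add_mem _ hp hq
  | smul c p _ hp =>
    simp only [Pi.smul_apply, smul_comm _ c]
    exact Submodule.smul_mem _ c hp

lemma eval_smul_mem_polySpan {N : Fin n → ℕ} {s : Finset (Fin n)} {i : Fin n} (hi : i ∉ s)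
    {P : Polynomial K} (hP : P.natDegree ≤ N i) {p : (Fin n → K) → E}
    (hp : p ∈ polySpan K E N s) :
    (fun y => P.eval (y i) • p y) ∈ polySpan K E N (insert i s) := by
  have : (fun y : Fin n → K => P.eval (y i) • p y) =
      ∑ m ∈ Finset.range (N i + 1), P.coeff m • fun y => y i ^ m • p y := by
    funext y
    rw [Polynomial.eval_eq_sum_range' (Nat.lt_succ_of_le hP), Finset.sum_smul, Finset.sum_apply]
    exact Finset.sum_congr rfl fun m _ => mul_smul _ _ _
  rw [this]
  exact Submodule.sum_mem _ fun m hm => Submodule.smul_mem _ _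
    (pow_smul_mem_polySpan hi (Nat.le_of_lt_succ (Finset.mem_range.1 hm)) hp)

lemma exists_finsupp_of_mem_polySpan {N : Fin n → ℕ} {s : Finset (Fin n)} {p : (Fin n → K) → E}
    (hp : p ∈ polySpan K E N s) : ∃ a : (Fin n → ℕ) →₀ E, (∀ γ ∈ a.support, ∀ i, γ i ≤ N i) ∧
      ∀ y, p y = a.sum fun γ c => (∏ i, y i ^ γ i) • c := by
  induction hp using Submodule.span_induction with
  | mem p hp =>
    obtain ⟨γ, e, hN, _, rfl⟩ := hp
    refine ⟨Finsupp.single γ e, fun δ hδ => ?_, fun y => ?_⟩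
    · rw [Finset.mem_singleton.1 (Finsupp.support_single_subset hδ)]
      exact hN
    · rw [Finsupp.sum_single_index]
      exact smul_zero _
  | zero => exact ⟨0, by simp, by simp⟩
  | add p q _ _ hp hq =>
    obtain ⟨a, ha, hpa⟩ := hp
    obtain ⟨b, hb, hqb⟩ := hq
    refine ⟨a + b, fun γ hγ => ?_, fun y => ?_⟩
    · rcases Finset.mem_union.1 (Finsupp.support_add hγ) with h | h
      · exact ha γ h
      · exact hb γ h
    · rw [Finsupp.sum_add_index' (fun _ => smul_zero _) (fun _ _ _ => smul_add _ _ _),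
        Pi.add_apply, hpa, hqb]
  | smul c p _ hp =>
    obtain ⟨a, ha, hpa⟩ := hp
    refine ⟨c • a, fun γ hγ => ha γ (Finsupp.support_smul hγ), fun y => ?_⟩
    rw [Finsupp.sum_smul_index' (fun _ => smul_zero _), Pi.smul_apply, hpa, Finsupp.smul_sum]
    simp only [smul_comm c]

end PolynomialPieces

/-! ### Interpolation in all variables -/

section Approximation

variable {K E : Type*} [NontriviallyNormedField K] [IsUltrametricDist K] [AddCommGroup E]
  [Module K E] {n : ℕ} {W : AddSubgroup E}

/-- Interpolating successively in all variables yields a piecewise polynomial function whose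
partial divided differences are close to those of `F`. -/
lemma exists_piecewise_polynomial (hW : ∀ z : K, ‖z‖ ≤ 1 → ∀ w ∈ W, z • w ∈ W) {ρ : K}
    (hρ : ρ ≠ 0) (hρ1 : ‖ρ‖ ≤ 1) {S : Fin n → Set K} (hS : ∀ i, Preperfect (S i))
    {N : Fin n → ℕ} {F : (Fin n → K) → E}
    (hF : ∀ i A, IsGrid S N A → ∀ B B' : Finset K, (B : Set K) ⊆ S i → (B' : Set K) ⊆ S i →
      B.card = N i + 1 → B'.card = N i + 1 → (∀ x ∈ B, ∀ y ∈ B', ‖x - y‖ < ‖ρ‖) →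
      gridDiff F (Function.update A i B) - gridDiff F (Function.update A i B') ∈ W)
    (s : Finset (Fin n)) :
    ∃ g : (Fin n → K) → E, (∀ A, IsGrid S N A → gridDiff F A - gridDiff g A ∈ W) ∧
      ∀ x ∈ Set.univ.pi S, ∀ z : Fin n → K, ∃ p ∈ polySpan K E N s, ∀ y ∈ Set.univ.pi S,
        (∀ i, ‖y i - x i‖ < ‖ρ‖) → (∀ k, k ∉ s → y k = z k) → g y = p y := by
  induction s using Finset.induction_on with
  | empty =>
    refine ⟨F, fun A _ => by rw [sub_self]; exact W.zero_mem, fun x _ z => ?_⟩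
    -- No variable has been interpolated yet, so freezing all of them at z leaves a constant.
    refine ⟨fun _ => F z, const_mem_polySpan _ _ _, fun y _ _ hyz => ?_⟩
    rw [show y = z from funext fun k => hyz k (Finset.notMem_empty k)]
  | insert i s hi ih =>
    obtain ⟨g, hg, hpoly⟩ := ih
    obtain ⟨Q, hQ⟩ := exists_isNodeChoice (hS i) (norm_pos_iff.2 hρ) (N i)
    refine ⟨interpAt Q i g, fun A hA => ?_, fun x hx z => ?_⟩
    · have := gridDiff_sub_interpAt_mem hW hρ hρ1 hQ (f := g) (S := S) (N := N) (i := i)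
        (fun A hA B B' hB hB' hc hc' hBB' => ?_) hA
      · have := W.add_mem (hg A hA) this
        rwa [sub_add_sub_cancel] at this
      -- The closeness hypothesis passes from F to g: their differences agree modulo the subgroup W,
      -- so nothing is lost from one variable to the next.
      · have h1 := hF i A hA B B' hB hB' hc hc' hBB'
        have h2 := hg _ (hA.update hB hc)
        have h3 := hg _ (hA.update hB' hc')
        have := W.add_mem (W.sub_mem h1 h2) h3
        convert this using 1
        abel
    · have hxi : x i ∈ S i := hx i (Set.mem_univ i)
      -- p q is the polynomial piece of g with variable i frozen at the node q.
      choose p hp hgp using fun q => hpoly x hx (Function.update z i q)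
      refine ⟨fun y => ∑ q ∈ Q (x i), (Lagrange.basis (Q (x i)) id q).eval (y i) • p q y, ?_,
        fun y hy hyx hyz => ?_⟩
      · have : (fun y : Fin n → K => ∑ q ∈ Q (x i),
            (Lagrange.basis (Q (x i)) id q).eval (y i) • p q y) = ∑ q ∈ Q (x i),
            fun y : Fin n → K => (Lagrange.basis (Q (x i)) id q).eval (y i) • p q y := by
          funext y
          rw [Finset.sum_apply]
        rw [this]
        refine Submodule.sum_mem _ fun q hq => eval_smul_mem_polySpan hi ?_ (hp q)
        rw [Lagrange.natDegree_basis (Set.injOn_id _) hq, hQ.card _ hxi]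
        exact le_rfl
      · rw [interpAt, interp, hQ.eq_of_close _ _ (hyx i)]
        refine Finset.sum_congr rfl fun q hq => ?_
        have hqS : q ∈ S i := hQ.subset _ hxi hq
        rw [hgp q (Function.update y i q) ?_ ?_ ?_, polySpan_eq_of_eqOn (hp q)]
        · intro k hk
          rw [Function.update_of_ne]
          rintro rfl
          exact hi hk
        · intro k _
          by_cases hk : k = i
          · subst hk; simpa using hqS
          · simpa [hk] using hy k (Set.mem_univ k)
        · intro k
          by_cases hk : k = i
          · subst hk; simpa using hQ.close _ hxi q hq
          · simpa [hk] using hyx k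
        · intro k hks
          by_cases hk : k = i
          · subst hk; simp
          · simpa [hk] using hyz k (by simp [hk, hks])

end Approximation

/-! ### Tuples and finite sets -/

section Domains

variable {K : Type*} {n : ℕ}

lemma mem_fullDom_pi {S : Fin n → Set K} {β : Fin n → ℕ}
    {x : (i : Fin n) → Fin (β i + 1) → K} :
    x ∈ fullDom (Set.univ.pi S) β ↔ ∀ i k, x i k ∈ S i := by
  refine ⟨fun h i k => ?_, fun h j i _ => h i (j i)⟩
  have := h (Function.update (fun _ => 0) i k) i (Set.mem_univ i)
  simpa using this

lemma exists_enumeration (m : ℕ) (B : Finset K) (h : B.card = m + 1) :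
    ∃ w : Fin (m + 1) → K, Function.Injective w ∧ Finset.univ.image w = B := by
  refine ⟨fun k => (B.equivFinOfCardEq h).symm k,
    Subtype.val_injective.comp (Equiv.injective _), ?_⟩
  ext b
  simp only [Finset.mem_image, Finset.mem_univ, true_and]
  exact ⟨fun ⟨k, hk⟩ => hk ▸ ((B.equivFinOfCardEq h).symm k).2,
    fun hb => ⟨B.equivFinOfCardEq h ⟨b, hb⟩, by simp⟩⟩

end Domains

/-! ### Uniform continuity of the difference quotients -/

section UniformContinuity

variable {K E : Type*} [NontriviallyNormedField K] [AddCommGroup E] [Module K E]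
  [TopologicalSpace E] [IsTopologicalAddGroup E] {n : ℕ}

/-- A Lebesgue number for the cover by preimages of cosets of W. -/
lemma exists_dist_lt_sub_mem {Y : Type*} [PseudoMetricSpace Y] [CompactSpace Y] {g : Y → E}
    (hg : Continuous g) {W : AddSubgroup E} (hW : IsOpen (W : Set E)) :
    ∃ δ > 0, ∀ x y, dist x y < δ → g x - g y ∈ W := by
  obtain ⟨δ, hδ, h⟩ := lebesgue_number_lemma_of_metric (s := Set.univ)
    (c := fun e : E => {y | g y - e ∈ W}) isCompact_univ
    (fun e => hW.preimage (hg.sub continuous_const))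
    (fun x _ => Set.mem_iUnion.2 ⟨g x, by simp [W.zero_mem]⟩)
  refine ⟨δ, hδ, fun x y hxy => ?_⟩
  obtain ⟨e, he⟩ := h x (Set.mem_univ x)
  have h1 : g x - e ∈ W := he (Metric.mem_ball_self hδ)
  have h2 : g y - e ∈ W := he (by rwa [Metric.mem_ball, dist_comm])
  have := W.sub_mem h1 h2
  rwa [sub_sub_sub_cancel_right] at this

lemma isCompact_fullDom {S : Fin n → Set K} (hS : ∀ i, IsCompact (S i)) (β : Fin n → ℕ) :
    IsCompact (fullDom (Set.univ.pi S) β) := by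
  have : fullDom (Set.univ.pi S) β = Set.univ.pi fun i => Set.univ.pi fun _ => S i := by
    ext x
    simp [mem_fullDom_pi, Set.mem_pi]
  rw [this]
  exact isCompact_univ_pi fun i => isCompact_univ_pi fun _ => hS i

lemma exists_gridDiff_sub_mem_of_card {S : Fin n → Set K} (hS : ∀ i, IsCompact (S i))
    {f : Set.univ.pi S → E} {F : (Fin n → K) → E} (hF : ∀ x : Set.univ.pi S, F x = f x)
    {β : Fin n → ℕ} {g : C(fullDom (Set.univ.pi S) β, E)} (hg : IsExtension f β g)
    {W : AddSubgroup E} (hW : IsOpen (W : Set E)) :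
    ∃ δ > 0, ∀ A A' : Fin n → Finset K, (∀ i, (A i : Set K) ⊆ S i) → (∀ i, (A' i : Set K) ⊆ S i) →
      (∀ i, (A i).card = β i + 1) → (∀ i, (A' i).card = β i + 1) →
      (∀ i, A i = A' i ∨ ∀ a ∈ A i, ∀ b ∈ A' i, ‖a - b‖ < δ) →
      gridDiff F A - gridDiff F A' ∈ W := by
  have := isCompact_iff_compactSpace.1 (isCompact_fullDom hS β)
  obtain ⟨δ, hδ, h⟩ := exists_dist_lt_sub_mem g.continuous hW
  refine ⟨δ, hδ, fun A A' hA hA' hc hc' hAA' => ?_⟩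
  -- The enumeration is a function of the set, so directions with A i = A' i contribute distance 0.
  choose w hwi hw using exists_enumeration (K := K)
  have mem : ∀ (A : Fin n → Finset K) (_ : ∀ i, (A i : Set K) ⊆ S i)
      (hc : ∀ i, (A i).card = β i + 1),
      (fun i => w (β i) (A i) (hc i)) ∈ distinctDom (Set.univ.pi S) β := by
    intro A hA hc
    refine ⟨mem_fullDom_pi.2 fun i k => hA i ?_, fun i j k hjk he => hjk.ne (hwi _ _ _ he)⟩
    exact (hw (β i) (A i) (hc i)).subset (Finset.mem_image_of_mem _ (Finset.mem_univ k))
  have val : ∀ (A : Fin n → Finset K) (hA : ∀ i, (A i : Set K) ⊆ S i)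
      (hc : ∀ i, (A i).card = β i + 1),
      g ⟨fun i => w (β i) (A i) (hc i), (mem A hA hc).1⟩ = gridDiff F A := by
    intro A hA hc
    rw [hg ⟨_, mem A hA hc⟩, diffQuot_eq_gridDiff hF]
    congr 1
    funext i
    exact hw _ _ _
  rw [← val A hA hc, ← val A' hA' hc']
  refine h _ _ ?_
  rw [Subtype.dist_eq, dist_pi_lt_iff hδ]
  intro i
  rw [dist_pi_lt_iff hδ]
  intro k
  rcases hAA' i with he | hlt
  · simp only [he, dist_self, hδ]
  · rw [dist_eq_norm]
    refine hlt _ ?_ _ ?_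
    · exact (hw (β i) (A i) (hc i)).subset (Finset.mem_image_of_mem _ (Finset.mem_univ k))
    · exact (hw (β i) (A' i) (hc' i)).subset (Finset.mem_image_of_mem _ (Finset.mem_univ k))

lemma exists_gridDiff_sub_mem {S : Fin n → Set K} (hS : ∀ i, IsCompact (S i))
    {f : Set.univ.pi S → E} {F : (Fin n → K) → E} (hF : ∀ x : Set.univ.pi S, F x = f x)
    {N : Fin n → ℕ} (hf : ∀ β : Fin n → ℕ, β ≤ N →
      ∃ g : C(fullDom (Set.univ.pi S) β, E), IsExtension f β g)
    {W : AddSubgroup E} (hW : IsOpen (W : Set E)) :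
    ∃ δ > 0, ∀ A, IsGrid S N A → ∀ i, ∀ B B' : Finset K, (B : Set K) ⊆ S i → (B' : Set K) ⊆ S i →
      B.card = N i + 1 → B'.card = N i + 1 → (∀ x ∈ B, ∀ y ∈ B', ‖x - y‖ < δ) →
      gridDiff F (Function.update A i B) - gridDiff F (Function.update A i B') ∈ W := by
  have h : ∀ β : Fin n → ℕ, β ≤ N → ∃ δ > 0, ∀ A A' : Fin n → Finset K,
      (∀ i, (A i : Set K) ⊆ S i) → (∀ i, (A' i : Set K) ⊆ S i) →
      (∀ i, (A i).card = β i + 1) → (∀ i, (A' i).card = β i + 1) →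
      (∀ i, A i = A' i ∨ ∀ a ∈ A i, ∀ b ∈ A' i, ‖a - b‖ < δ) →
      gridDiff F A - gridDiff F A' ∈ W := fun β hβ => by
    obtain ⟨g, hg⟩ := hf β hβ
    exact exists_gridDiff_sub_mem_of_card hS hF hg hW
  choose! δ hδ h using h
  have hfin : (Set.Iic N).Finite := Set.finite_Iic N
  -- Only finitely many orders β ≤ N occur, so one radius serves them all.
  obtain ⟨r, hr, hrδ⟩ : ∃ r > 0, ∀ β ≤ N, r ≤ δ β := by
    have : ∀ᶠ r : ℝ in 𝓝[>] 0, ∀ β ∈ Set.Iic N, r ≤ δ β :=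
      (eventually_all_finite hfin).2 fun β hβ =>
        mem_nhdsWithin_of_mem_nhds (Iic_mem_nhds (hδ β hβ))
    obtain ⟨r, h1, h2⟩ := (this.and self_mem_nhdsWithin).exists
    exact ⟨r, h2, h1⟩
  refine ⟨r, hr, fun A hA i B B' hB hB' hc hc' hBB' => ?_⟩
  have gB := hA.update hB hc
  have gB' := hA.update hB' hc'
  have hpos := fun k => Finset.card_pos.2 (gB.nonempty k)
  -- Off direction i the grid may have fewer than N k + 1 points; the order is read off from the
  -- cardinalities.
  refine h (fun k => (Function.update A i B k).card - 1) (fun k => ?_) _ _ gB.subset gB'.subset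
    (fun k => ?_) (fun k => ?_) fun k => ?_
  · exact Nat.sub_le_iff_le_add.2 (gB.card_le k)
  · have := hpos k
    omega
  · have := hpos k
    by_cases hk : k = i
    · subst hk; simp [hc, hc']
    · simp only [Function.update_of_ne hk] at this ⊢
      omega
  · by_cases hk : k = i
    · subst hk
      right
      simp only [Function.update_self]
      refine fun a ha b hb => (hBB' a ha b hb).trans_le (hrδ _ fun l => ?_)
      exact Nat.sub_le_iff_le_add.2 (gB.card_le l)
    · left
      simp [hk]

end UniformContinuity

/-! ### Locally polynomial functions are C^α -/

section Extension

variable {K : Type*} {n : ℕ}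

/-- Writing t^(m+1) = b t^m + (t − b) t^m, the second summand has the divided difference of t^m with
b removed; so no denominators survive. -/
lemma exists_continuous_divDiff_pow [Field K] [TopologicalSpace K] [IsTopologicalRing K]
    {ι : Type*} (m : ℕ) (J : Finset ι) :
    ∃ H : (ι → K) → K, Continuous H ∧
      ∀ z, Function.Injective z → divDiff (fun t : K => t ^ m) (J.image z) = H z := by
  induction m generalizing J with
  | zero =>
    rcases J.eq_empty_or_nonempty with rfl | hJ
    · exact ⟨fun _ => 0, continuous_const, fun z _ => rfl⟩
    · refine ⟨fun _ => (1 : Polynomial K).coeff (J.card - 1), continuous_const, fun z hz => ?_⟩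
      have hc : (J.image z).card = J.card := Finset.card_image_of_injective _ hz
      have := divDiff_eval (P := (1 : Polynomial K)) (A := J.image z) (by
        rw [Polynomial.degree_one, hc]
        exact_mod_cast hJ.card_pos)
      rw [hc] at this
      simpa using this
  | succ m ih =>
    rcases J.eq_empty_or_nonempty with rfl | ⟨b, hb⟩
    · exact ⟨fun _ => 0, continuous_const, fun z _ => rfl⟩
    · obtain ⟨H, hH, hHz⟩ := ih J
      obtain ⟨H', hH', hHz'⟩ := ih (J.erase b)
      refine ⟨fun z => z b * H z + H' z, ((continuous_apply b).mul hH).add hH', fun z hz => ?_⟩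
      beta_reduce
      rw [← hHz z hz, ← hHz' z hz, Finset.image_erase hz,
        divDiff_erase _ (Finset.mem_image_of_mem z hb), divDiff, divDiff, divDiff, Finset.mul_sum,
        ← Finset.sum_add_distrib]
      refine Finset.sum_congr rfl fun a _ => ?_
      simp only [smul_eq_mul]
      ring

lemma gridDiff_sum_monomial [Field K] {E : Type*} [AddCommGroup E] [Module K E] (a : (Fin n → ℕ) →₀ E) (A : Fin n → Finset K) :
    gridDiff (fun y => a.sum fun γ c => (∏ i, y i ^ γ i) • c) A =
      ∑ γ ∈ a.support, (∏ i, divDiff (fun t : K => t ^ γ i) (A i)) • a γ := by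
  have := gridDiff_sum_smul a.support (fun _ => (1 : K))
    (fun γ (y : Fin n → K) => (∏ i, y i ^ γ i) • a γ) A
  simp only [one_smul] at this
  rw [show (fun y : Fin n → K => a.sum fun γ c => (∏ i, y i ^ γ i) • c) =
    fun y => ∑ γ ∈ a.support, (∏ i, y i ^ γ i) • a γ from rfl, this]
  exact Finset.sum_congr rfl fun γ _ => gridDiff_prod_smul (fun i t => t ^ γ i) (a γ) A

/-- Points without isolation can be moved apart one at a time, each ball meeting S in an infinite
set. -/
lemma exists_injective_close [NormedField K] {S : Set K} (hS : Preperfect S) {ε : ℝ} (hε : 0 < ε)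
    (m : ℕ) (w : Fin m → K) (hw : ∀ k, w k ∈ S) :
    ∃ w' : Fin m → K, (∀ k, w' k ∈ S) ∧ Function.Injective w' ∧ ∀ k, dist (w k) (w' k) < ε := by
  induction m with
  | zero => exact ⟨w, hw, fun i => i.elim0, fun i => i.elim0⟩
  | succ m ih =>
    obtain ⟨v, hvS, hvi, hv⟩ := ih (fun k => w k.succ) fun k => hw _
    have hinf : (Metric.ball (w 0) ε ∩ S).Infinite :=
      Set.Infinite.of_accPt ((hS _ (hw 0)).nhds_inter (Metric.ball_mem_nhds _ hε))
    obtain ⟨t, ⟨htb, htS⟩, htv⟩ := hinf.exists_notMem_finset (Finset.univ.image v)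
    refine ⟨Fin.cons t v, fun k => ?_, ?_, fun k => ?_⟩
    · refine Fin.cases ?_ (fun k => ?_) k
      · simpa using htS
      · simpa using hvS k
    · refine Fin.cons_injective_iff.2 ⟨?_, hvi⟩
      rintro ⟨k, hk⟩
      exact htv (Finset.mem_image.2 ⟨k, Finset.mem_univ k, hk⟩)
    · refine Fin.cases ?_ (fun k => ?_) k
      · simpa [dist_comm] using htb
      · simpa using hv k

lemma fullDom_subset_closure_distinctDom [NormedField K] {S : Fin n → Set K}
    (hS : ∀ i, Preperfect (S i)) (β : Fin n → ℕ) :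
    fullDom (Set.univ.pi S) β ⊆ closure (distinctDom (Set.univ.pi S) β) := by
  intro x hx
  rw [Metric.mem_closure_iff]
  intro ε hε
  choose w hwS hwi hw using fun i =>
    exists_injective_close (hS i) hε _ (x i) (mem_fullDom_pi.1 hx i)
  refine ⟨w, ⟨mem_fullDom_pi.2 hwS, fun i j k hjk h => hjk.ne (hwi i h)⟩, ?_⟩
  rw [dist_pi_lt_iff hε]
  intro i
  rw [dist_pi_lt_iff hε]
  exact hw i

variable {E : Type*} [NormedField K] [AddCommGroup E] [Module K E] [TopologicalSpace E]
  [IsTopologicalAddGroup E] [ContinuousSMul K E]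

/-- Partial divided differences of a locally polynomial function have limits everywhere. -/
lemma exists_tendsto_gridDiff {S : Fin n → Set K} {F : (Fin n → K) → E}
    (hF : ∀ x ∈ Set.univ.pi S, ∃ O, IsOpen O ∧ x ∈ O ∧ ∃ a : (Fin n → ℕ) →₀ E,
      ∀ y ∈ Set.univ.pi S, y ∈ O → F y = a.sum fun γ c => (∏ i, y i ^ γ i) • c)
    {β : Fin n → ℕ} {x : (i : Fin n) → Fin (β i + 1) → K}
    (hx : x ∈ fullDom (Set.univ.pi S) β) (k : ℕ) :
    ∀ J : (i : Fin n) → Finset (Fin (β i + 1)), ∑ i, (J i).card = k →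
      ∃ L, Tendsto (fun z : (i : Fin n) → Fin (β i + 1) → K =>
        gridDiff F fun i => (J i).image (z i)) (𝓝[distinctDom (Set.univ.pi S) β] x) (𝓝 L) := by
  induction k using Nat.strong_induction_on with
  | _ k ih =>
  intro J hJk
  by_cases hempty : ∃ i, J i = ∅
  · obtain ⟨i, hi⟩ := hempty
    refine ⟨0, tendsto_const_nhds.congr fun z => (gridDiff_of_empty F (i := i) ?_).symm⟩
    rw [hi, Finset.image_empty]
  push Not at hempty
  -- If the selected entries of x coincide in every direction, the grid shrinks to one point, near
  -- which F is a single polynomial.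
  by_cases hdiag : ∀ i, ∀ a ∈ J i, ∀ b ∈ J i, x i a = x i b
  · choose j hj using hempty
    obtain ⟨O, hO, hyO, a, ha⟩ := hF _ (hx j)
    choose H hHc hH using fun (γ : Fin n → ℕ) (i : Fin n) =>
      exists_continuous_divDiff_pow (K := K) (γ i) (J i)
    have hcont : Continuous fun z : (i : Fin n) → Fin (β i + 1) → K =>
        ∑ γ ∈ a.support, (∏ i, H γ i (z i)) • a γ :=
      continuous_finsetSum _ fun γ _ => (continuous_finsetProd _ fun i _ =>
        (hHc γ i).comp (continuous_apply i)).smul continuous_const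
    refine ⟨_, ((hcont.tendsto x).mono_left nhdsWithin_le_nhds).congr' ?_⟩
    have hev : ∀ᶠ z in 𝓝 x, ∀ l : (i : Fin n) → Fin (β i + 1), (∀ i, l i ∈ J i) →
        (fun i => z i (l i)) ∈ O := by
      refine eventually_all.2 fun l => ?_
      by_cases hl : ∀ i, l i ∈ J i
      · have hc : Continuous fun z : (i : Fin n) → Fin (β i + 1) → K => fun i => z i (l i) :=
          continuous_pi fun i => (continuous_apply (l i)).comp (continuous_apply i)
        have hxl : (fun i => x i (l i)) ∈ O := by
          rwa [show (fun i => x i (l i)) = fun i => x i (j i) from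
            funext fun i => hdiag i _ (hl i) _ (hj i)]
        filter_upwards [hc.continuousAt.preimage_mem_nhds (hO.mem_nhds hxl)] with z hz _
        exact hz
      · exact Eventually.of_forall fun z h => absurd h hl
    filter_upwards [nhdsWithin_le_nhds hev, self_mem_nhdsWithin] with z hz hzD
    rw [gridDiff_congr (g := fun y => a.sum fun γ c => (∏ i, y i ^ γ i) • c),
      gridDiff_sum_monomial]
    · refine Finset.sum_congr rfl fun γ _ => ?_
      congr 1
      exact Finset.prod_congr rfl fun i _ => (hH γ i _ (injective_of_mem_distinctDom hzD i)).symm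
    · intro y hy
      choose l hl hly using fun i => Finset.mem_image.1 (hy i)
      obtain rfl : (fun i => z i (l i)) = y := funext hly
      exact ha _ (hzD.1 l) (hz l hl)
  · push Not at hdiag
    -- Otherwise the recursion in direction i has a denominator with nonzero limit, and its grids
    -- have fewer points; this is why arbitrary index subsets J are allowed.
    obtain ⟨i, a, ha, b, hb, hab⟩ := hdiag
    have step : ∀ c ∈ J i, ∃ L, Tendsto (fun z : (i : Fin n) → Fin (β i + 1) → K =>
        gridDiff F fun k => (Function.update J i ((J i).erase c) k).image (z k))
        (𝓝[distinctDom (Set.univ.pi S) β] x) (𝓝 L) := by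
      intro c hc
      refine ih _ ?_ _ rfl
      rw [← hJk]
      refine Finset.sum_lt_sum (fun k _ => ?_) ⟨i, Finset.mem_univ i, ?_⟩
      · by_cases hk : k = i
        · subst hk
          simpa using Finset.card_le_card (Finset.erase_subset c (J k))
        · simp [hk]
      · simpa using Finset.card_erase_lt_of_mem hc
    obtain ⟨L, hL⟩ := step b hb
    obtain ⟨L', hL'⟩ := step a ha
    have hcoord : ∀ c, Tendsto (fun z : (i : Fin n) → Fin (β i + 1) → K => z i c)
        (𝓝[distinctDom (Set.univ.pi S) β] x) (𝓝 (x i c)) := fun c =>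
      (((continuous_apply c).comp (continuous_apply i)).tendsto x).mono_left nhdsWithin_le_nhds
    refine ⟨_, ((((hcoord a).sub (hcoord b)).inv₀ (sub_ne_zero.2 hab)).smul
      (hL.sub hL')).congr' ?_⟩
    filter_upwards [self_mem_nhdsWithin] with z hz
    have hinj := injective_of_mem_distinctDom hz i
    have hupd : ∀ c, (fun k => (Function.update J i ((J i).erase c) k).image (z k)) =
        Function.update (fun k => (J k).image (z k)) i (((J i).image (z i)).erase (z i c)) := by
      intro c
      funext k
      by_cases hk : k = i
      · subst hk
        simp [Finset.image_erase hinj]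
      · simp [hk]
    rw [hupd, hupd]
    exact (gridDiff_eq_smul_sub F (fun k => (J k).image (z k)) i
      (Finset.mem_image_of_mem (z i) ha) (Finset.mem_image_of_mem (z i) hb)
      (hinj.ne (ne_of_apply_ne (x i) hab))).symm

lemma isCAlphaOnCartesian_of_locally_polynomial [T2Space E] {S : Fin n → Set K}
    (hS : ∀ i, Preperfect (S i)) {f : Set.univ.pi S → E} {F : (Fin n → K) → E}
    (hfF : ∀ x : Set.univ.pi S, F x = f x)
    (hF : ∀ x ∈ Set.univ.pi S, ∃ O, IsOpen O ∧ x ∈ O ∧ ∃ a : (Fin n → ℕ) →₀ E,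
      ∀ y ∈ Set.univ.pi S, y ∈ O → F y = a.sum fun γ c => (∏ i, y i ^ γ i) • c)
    (α : Fin n → ℕ∞) : IsCAlphaOnCartesian α f := by
  intro β _
  have hlim : ∀ x ∈ fullDom (Set.univ.pi S) β, ∃ L,
      Tendsto (fun z : (i : Fin n) → Fin (β i + 1) → K =>
        gridDiff F fun i => Finset.univ.image (z i)) (𝓝[distinctDom (Set.univ.pi S) β] x) (𝓝 L) :=
    fun x hx => exists_tendsto_gridDiff hF hx _ (fun _ => Finset.univ) rfl
  refine ⟨⟨_, (continuousOn_extendFrom (fullDom_subset_closure_distinctDom hS β)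
    hlim).domRestrict⟩, fun x => ?_⟩
  rw [diffQuot_eq_gridDiff hfF]
  obtain ⟨L, hL⟩ := hlim x.1 x.2.1
  change extendFrom _ _ x.1 = _
  rw [extendFrom_eq (subset_closure x.2) hL]
  -- At a point of the distinct domain the limit must be the value there.
  exact tendsto_nhds_unique (hL.mono_left (pure_le_nhdsWithin x.2)) (tendsto_pure_nhds _ _)

end Extension

lemma extend_apply {X E : Type*} [Zero E] {U : Set X} (f : U → E) (x : U) :
    Function.extend Subtype.val f 0 (x : X) = f x :=
  Subtype.val_injective.extend_apply f 0 x

/-! ### Neighbourhoods in C^α(U,E) and the approximation -/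

section Topology

variable {K E : Type*} [NontriviallyNormedField K] [AddCommGroup E]
  [Module K E] [TopologicalSpace E] {n : ℕ}

lemma isCAlpha_of_isLocPol [IsTopologicalAddGroup E] [ContinuousSMul K E] [T2Space E]
    {U : Set (Fin n → K)} {α : Fin n → ℕ∞} {f : U → E} (hf : IsLocPol α f) : IsCAlpha α f := by
  rintro _ hV ⟨S, hS, rfl⟩
  refine isCAlphaOnCartesian_of_locally_polynomial hS (F := Function.extend Subtype.val f 0)
    (fun x => extend_apply f (Set.inclusion hV.1 x)) (fun x hx => ?_) α
  obtain ⟨V', ⟨hV'U, O, hO, rfl⟩, hxV', a, _, ha⟩ := hf x (hV.1 hx)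
  refine ⟨O, hO, hxV'.2, a, fun y hy hyO => ?_⟩
  exact (extend_apply f ⟨y, hV.1 hy⟩).trans (ha ⟨y, hV.1 hy, hyO⟩)

lemma extMap_apply_eq_gridDiff {U : Set (Fin n → K)} {α : Fin n → ℕ∞} {V : Set (Fin n → K)}
    (hV : IsRelOpen U V) (hc : IsCartesian V) {β : Fin n → ℕ} (hβ : MultiLE β α)
    (f : CAlpha E U α) {F : (Fin n → K) → E} (hF : ∀ x : U, F x = f.1 x)
    (x : distinctDom V β) : extMap V hV hc β hβ f ⟨x.1, x.2.1⟩ =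
      gridDiff F fun i => Finset.univ.image (x.1 i) := by
  rw [← diffQuot_eq_gridDiff (f := restr hV.1 f.1) (fun y => hF (Set.inclusion hV.1 y))]
  exact Classical.choose_spec (f.2 V hV hc β hβ) x

/-- Uniform closeness of all partial difference quotients up to order `N` forces membership in a
given neighbourhood. -/
lemma exists_order_of_mem_nhds [IsUltrametricDist K] [IsTopologicalAddGroup E]
    (hE : IsLocallyConvex K E) {U : Set (Fin n → K)}
    {α : Fin n → ℕ∞} (f : CAlpha E U α) {s : Set (CAlpha E U α)} (hs : s ∈ 𝓝 f) :
    ∃ N : Fin n → ℕ, MultiLE N α ∧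
      ∃ W : Submodule (NormedField.valuation (K := K)).integer E, IsOpen (W : Set E) ∧
        ∀ g : CAlpha E U α, (∀ (V : Set (Fin n → K)) (hV : IsRelOpen U V) (hc : IsCartesian V)
          (β : Fin n → ℕ) (hβ : MultiLE β α), β ≤ N →
            ∀ x, extMap V hV hc β hβ g x - extMap V hV hc β hβ f x ∈ W) → g ∈ s := by
  -- The sets with the required property form a filter, so it suffices to test each map Δ_{β,V} on
  -- subbasic compact-open sets.
  let L : Filter (CAlpha E U α) :=
    { sets := {s | ∃ N : Fin n → ℕ, MultiLE N α ∧
        ∃ W : Submodule (NormedField.valuation (K := K)).integer E, IsOpen (W : Set E) ∧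
          ∀ g : CAlpha E U α, (∀ (V : Set (Fin n → K)) (hV : IsRelOpen U V) (hc : IsCartesian V)
            (β : Fin n → ℕ) (hβ : MultiLE β α), β ≤ N →
              ∀ x, extMap V hV hc β hβ g x - extMap V hV hc β hβ f x ∈ W) → g ∈ s}
      univ_sets := ⟨0, fun i => by simp, ⊤, by simp, fun _ _ => trivial⟩
      sets_of_superset := by
        rintro s t ⟨N, hN, W, hW, h⟩ hst
        exact ⟨N, hN, W, hW, fun g hg => hst (h g hg)⟩
      inter_sets := by
        rintro s t ⟨N, hN, W, hW, h⟩ ⟨N', hN', W', hW', h'⟩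
        refine ⟨N ⊔ N', fun i => ?_, W ⊓ W', hW.inter hW', fun g hg => ⟨h g ?_, h' g ?_⟩⟩
        · rcases le_total (N i) (N' i) with hle | hle
          · simpa [hle] using hN' i
          · simpa [hle] using hN i
        · exact fun V hV hc β hβ hβN x => (hg V hV hc β hβ (hβN.trans le_sup_left) x).1
        · exact fun V hV hc β hβ hβN x => (hg V hV hc β hβ (hβN.trans le_sup_right) x).2 }
  suffices L ≤ 𝓝 f from this hs
  rw [CAlpha.instTopologicalSpace]
  simp only [nhds_iInf, nhds_induced, le_iInf_iff, ← tendsto_iff_comap,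
    ContinuousMap.tendsto_nhds_compactOpen]
  intro V hV hc β hβ C hC O hO hCO
  -- The image of C is compact in O, so adding a small neighbourhood T of 0 keeps it in O.
  obtain ⟨T, hT, hTO⟩ := compact_open_separated_add_right
    (hC.image (extMap V hV hc β hβ f).continuous) hO hCO.image_subset
  obtain ⟨W, hW, hWT⟩ := hE.mem_iff.1 hT
  refine ⟨β, hβ, W, hW, fun g hg x hx => hTO ?_⟩
  rw [← add_sub_cancel (extMap V hV hc β hβ f x) (extMap V hV hc β hβ g x)]
  exact Set.add_mem_add (Set.mem_image_of_mem _ hx) (hWT (hg V hV hc β hβ le_rfl x))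

/-- All V are handled at once, since grids in V are grids in U. -/
lemma exists_isLocPol_extMap_sub_mem [IsUltrametricDist K] [IsTopologicalAddGroup E]
    [ContinuousSMul K E] [T2Space E] {S : Fin n → Set K} (hS : ∀ i, Preperfect (S i))
    (hcpt : ∀ i, IsCompact (S i)) {α : Fin n → ℕ∞} (f : CAlpha E (Set.univ.pi S) α)
    {N : Fin n → ℕ} (hN : MultiLE N α) {W : AddSubgroup E} (hWo : IsOpen (W : Set E))
    (hW : ∀ z : K, ‖z‖ ≤ 1 → ∀ w ∈ W, z • w ∈ W) :
    ∃ g : CAlpha E (Set.univ.pi S) α, IsLocPol α g.1 ∧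
      ∀ (V : Set (Fin n → K)) (hV : IsRelOpen (Set.univ.pi S) V) (hc : IsCartesian V)
        (β : Fin n → ℕ) (hβ : MultiLE β α), β ≤ N →
          ∀ x, extMap V hV hc β hβ g x - extMap V hV hc β hβ f x ∈ W := by
  have hUself : IsRelOpen (Set.univ.pi S) (Set.univ.pi S) := ⟨subset_rfl, Set.univ, isOpen_univ, (Set.inter_univ _).symm⟩
  set F : (Fin n → K) → E := Function.extend Subtype.val f.1 0
  have hF : ∀ x : Set.univ.pi S, F x = f.1 x := extend_apply f.1
  have hle : ∀ {γ : Fin n → ℕ}, (∀ i, γ i ≤ N i) → MultiLE γ α := fun h i =>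
    (Nat.cast_le.2 (h i)).trans (hN i)
  obtain ⟨δ, hδ, hδF⟩ := exists_gridDiff_sub_mem hcpt hF (N := N)
    (fun β hβ => f.2 _ hUself ⟨S, hS, rfl⟩ β (hle hβ)) hWo
  obtain ⟨ρ, hρ, hρδ⟩ := NormedField.exists_norm_lt K (lt_min hδ one_pos)
  obtain ⟨G, hFG, hG⟩ := exists_piecewise_polynomial hW (norm_pos_iff.1 hρ)
    (hρδ.le.trans (min_le_right _ _)) hS (N := N) (F := F)
    (fun i A hA B B' hB hB' hc hc' hBB' => hδF A hA i B B' hB hB' hc hc' fun x hx y hy =>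
      (hBB' x hx y hy).trans (hρδ.trans_le (min_le_left _ _))) Finset.univ
  have hloc : IsLocPol α (fun y : Set.univ.pi S => G y) := by
    intro x hx
    obtain ⟨p, hp, hGp⟩ := hG x hx x
    obtain ⟨a, ha, hpa⟩ := exists_finsupp_of_mem_polySpan hp
    refine ⟨Set.univ.pi S ∩ Metric.ball x ‖ρ‖, ⟨Set.inter_subset_left, _, Metric.isOpen_ball, rfl⟩,
      ⟨hx, Metric.mem_ball_self hρ⟩, a, fun γ hγ => hle (ha γ hγ), fun y => ?_⟩
    rw [← hpa]
    refine hGp y.1 y.2.1 (fun i => ?_) fun k hk => absurd (Finset.mem_univ k) hk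
    rw [← dist_eq_norm]
    exact (dist_le_pi_dist _ _ i).trans_lt y.2.2
  refine ⟨⟨_, isCAlpha_of_isLocPol hloc⟩, hloc, fun V hV hc β hβ hβN x => ?_⟩
  -- An open subgroup is closed, so membership in W extends from the dense set of tuples with
  -- distinct entries.
  have hclosed : IsClosed (W : Set E) := W.isClosed_of_isOpen hWo
  have hx : x ∈ closure {y : fullDom V β | y.1 ∈ distinctDom V β} := by
    rw [closure_subtype]
    have hVsub : fullDom V β ⊆ closure (distinctDom V β) := by
      obtain ⟨S', hS', rfl⟩ := hc
      exact fullDom_subset_closure_distinctDom hS' β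
    refine closure_mono (fun y hy => ?_) (hVsub x.2)
    exact ⟨⟨y, hy.1⟩, hy, rfl⟩
  refine closure_minimal (fun y hy => ?_) (hclosed.preimage
    ((ContinuousMap.continuous _).sub (ContinuousMap.continuous _))) hx
  change extMap V hV hc β hβ _ ⟨y.1, hy.1⟩ - extMap V hV hc β hβ f ⟨y.1, hy.1⟩ ∈ W
  rw [extMap_apply_eq_gridDiff hV hc hβ ⟨_, isCAlpha_of_isLocPol hloc⟩ (F := G)
      (fun _ => rfl) ⟨y.1, hy⟩,
    extMap_apply_eq_gridDiff hV hc hβ f hF ⟨y.1, hy⟩, ← neg_sub]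
  refine W.neg_mem (hFG _ ⟨fun i => ?_, fun i => ?_, fun i => ?_⟩)
  · intro t ht
    obtain ⟨k, _, rfl⟩ := Finset.mem_image.1 (Finset.mem_coe.1 ht)
    exact mem_fullDom_pi.1 (fun j => hV.1 (y.2 j)) i k
  · exact Finset.univ_nonempty.image _
  · exact Finset.card_image_le.trans (by simpa using hβN i)

end Topology
end PartialDiff

end

theorem theoremB {K : Type*} [NontriviallyNormedField K] [IsUltrametricDist K]
    [CompleteSpace K] {E : Type*} [AddCommGroup E] [Module K E] [TopologicalSpace E]
    [IsTopologicalAddGroup E] [ContinuousSMul K E] [T2Space E]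
    (hE : PartialDiff.IsLocallyConvex K E) {n : ℕ} (U : Set (Fin n → K))
    (hcpt : IsCompact U) (hcart : PartialDiff.IsCartesian U) (α : Fin n → ℕ∞) :
    (∀ f : U → E, PartialDiff.IsLocPol α f → PartialDiff.IsCAlpha α f) ∧
      Dense {f : PartialDiff.CAlpha E U α | PartialDiff.IsLocPol α f.1} := by
  refine ⟨fun f hf => PartialDiff.isCAlpha_of_isLocPol hf, fun f => ?_⟩
  -- An empty product says nothing about compactness of its factors; every function on it is locally
  -- polynomial.
  rcases U.eq_empty_or_nonempty with hempty | hne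
  · exact subset_closure fun x hx => absurd hx (by rw [hempty]; exact Set.notMem_empty x)
  obtain ⟨S, hS, rfl⟩ := hcart
  have hcptS : ∀ i, IsCompact (S i) := fun i => by
    rw [← Set.eval_image_univ_pi hne]
    exact hcpt.image (continuous_apply i)
  rw [mem_closure_iff_nhds]
  intro s hs
  obtain ⟨N, hN, W, hWo, hWs⟩ := PartialDiff.exists_order_of_mem_nhds hE f hs
  obtain ⟨g, hg, hgf⟩ := PartialDiff.exists_isLocPol_extMap_sub_mem hS hcptS f hN
    (W := W.toAddSubgroup) hWo fun z hz w hw => W.smul_mem ⟨z, hz⟩ hw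
  exact ⟨g, hWs g hgf, hg⟩
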